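/- Let $f\in C^1(\mathbb{R})$ satisfy $f(u)>0$ and $f'(u)\ge 0$ for all $u\in\mathbb{R}$, and let $\lambda>0$. For $L>0$ consider the Dirichlet problem $$u''(x)+\lambda f(u(x))=0 \ \text{ in } (0,L),\qquad u(0)=u(L)=0, \tag{D}$$ whose solutions are functions $u\in C^2((0,L))\cap C([0,L])$. Set $F(u)=\int_0^u f(s)\,ds$, $g(u)=f(u)^2-2f'(u)F(u)$, and, for $C>0$, $$L(C)=\frac{1}{\sqrt{\lambda}}\int_{-\sqrt{2C}}^{\sqrt{2C}}\frac{dv}{f\left(F^{-1}\left(C-\frac{v^2}{2}\right)\right)} .$$ (i) If $g(u)>0$ for all $u\in(0,\infty)$, then $C\mapsto L(C)$ is strictly increasing on $(0,\infty)$, and for every $L>0$ problem (D) has at most one solution. (ii) If $f\in C^2(\mathbb{R})$ and $f''(u)>0$ for all $u>0$, then for every $L>0$ problem (D) has at most two solutions. The solutions are ordered: if $u_1\ne u_2$ are solutions of (D), then either $u_1<u_2$ on $(0,L)$ or $u_2<u_1$ on $(0,L)$. -/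

import Mathlib

/-- The primitive `F(u) = ∫₀ᵘ f(s) ds`. -/
noncomputable def primitive (f : ℝ → ℝ) (u : ℝ) : ℝ :=
  ∫ s in (0 : ℝ)..u, f s

/-- The function `g(u) = f(u)² - 2 f'(u) F(u)`. -/
noncomputable def gFun (f : ℝ → ℝ) (u : ℝ) : ℝ :=
  f u ^ 2 - 2 * deriv f u * primitive f u

/-- The time map
`L(C) = λ^(-1/2) ∫_{-√(2C)}^{√(2C)} dv / f(F⁻¹(C - v²/2))`
of the Dirichlet problem. If `f` is positive and nondecreasing then `F` is injective and its range
contains `[0, ∞)`, so that `Function.invFun` is the inverse of `F` at all points used here. -/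
noncomputable def timeMap (f : ℝ → ℝ) (lam C : ℝ) : ℝ :=
  (1 / √lam) * ∫ v in (-√(2 * C))..(√(2 * C)),
    1 / f (Function.invFun (primitive f) (C - v ^ 2 / 2))

/-- `u` is a classical solution of `u'' + λ f(u) = 0` in `(0, L)`, `u(0) = u(L) = 0`.
Only the values of `u` on `[0, L]` matter. -/
structure IsDirichletSolution (f : ℝ → ℝ) (lam L : ℝ) (u : ℝ → ℝ) : Prop where
  continuousOn : ContinuousOn u (Set.Icc 0 L)
  contDiffOn : ContDiffOn ℝ 2 u (Set.Ioo 0 L)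
  equation : ∀ x ∈ Set.Ioo 0 L, deriv (deriv u) x + lam * f (u x) = 0
  left_eq : u 0 = 0
  right_eq : u L = 0

/-! A solution is determined by its initial velocity `V 0 > 0`. Conservation of `V² / 2 + λ F(U)`
makes it symmetric about `L / 2`, and the substitution `v = V / √λ` gives `L = L(C)` with `C = V(0)²
/ (2λ)` (`eq_timeMap`).

(i) Rescaling the time map to `[-1, 1]` makes the squared integrand `2 / (1 - t²)` times `F / f²` at
`F⁻¹(C(1 - t²))` for `|t| < 1`. Since `(F / f²)' = g / f³`, the integrand increases with `C`; thus
`L` determines `C`, and `C` determines the solution.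

(ii) Energy orders solutions by initial velocity (`lt_of_snd_zero_lt`). For three ordered solutions,
the Wronskian of the consecutive differences vanishes at both ends, yet strict convexity of `f`
makes its derivative positive (`not_lt_lt`). -/

open Set

/-! ### Regularity up to the endpoints. -/

/-- A solution of the phase plane system `U' = V`, `V' = -λ f(U)` on the closed interval `[0, L]`
with `U` vanishing at both endpoints. -/
structure IsPhaseSolution (f : ℝ → ℝ) (lam L : ℝ) (U V : ℝ → ℝ) : Prop where
  hasDerivAt_fst : ∀ x ∈ Icc 0 L, HasDerivAt U (V x) x
  hasDerivAt_snd : ∀ x ∈ Icc 0 L, HasDerivAt V (-(lam * f (U x))) x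
  left_eq : U 0 = 0
  right_eq : U L = 0

/-- A Dirichlet solution agrees on `[0, L]` with a function that is twice differentiable up to the
endpoints. -/
theorem IsDirichletSolution.exists_isPhaseSolution {f : ℝ → ℝ} (hf : Continuous f)
    {lam L : ℝ} (hL : 0 < L) {u : ℝ → ℝ} (hu : IsDirichletSolution f lam L u) :
    ∃ U V, EqOn u U (Icc 0 L) ∧ IsPhaseSolution f lam L U V := by
  -- Extending `u` by constants outside `[0, L]` makes the right-hand side continuous on `ℝ`;
  -- integrating it twice from the midpoint gives two-sided derivatives even at `0` and `L`.
  let q : ℝ → ℝ := fun x => -(lam * f (IccExtend hL.le (domRestrict (Icc 0 L) u) x))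
  have hq : Continuous q :=
    (continuous_const.mul (hf.comp hu.continuousOn.domRestrict.Icc_extend')).neg
  have hqu : ∀ x ∈ Icc 0 L, q x = -(lam * f (u x)) := by
    intro x hx
    simp only [q, IccExtend_of_mem hL.le _ hx, domRestrict_apply]
  let V : ℝ → ℝ := fun x => deriv u (L / 2) + ∫ t in (L / 2)..x, q t
  have hV : ∀ x, HasDerivAt V (q x) x := fun x =>
    (hq.integral_hasStrictDerivAt (L / 2) x).hasDerivAt.const_add _
  have hVc : Continuous V := continuous_iff_continuousAt.2 fun x => (hV x).continuousAt
  let U : ℝ → ℝ := fun x => u (L / 2) + ∫ t in (L / 2)..x, V t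
  have hU : ∀ x, HasDerivAt U (V x) x := fun x =>
    (hVc.integral_hasStrictDerivAt (L / 2) x).hasDerivAt.const_add _
  have hUc : Continuous U := continuous_iff_continuousAt.2 fun x => (hU x).continuousAt
  have hm : L / 2 ∈ Ioo 0 L := ⟨by linarith, by linarith⟩
  have hdu : DifferentiableOn ℝ (deriv u) (Ioo 0 L) :=
    (((contDiffOn_succ_iff_deriv_of_isOpen (n := 1) isOpen_Ioo).1 hu.contDiffOn).2.2).differentiableOn
      one_ne_zero
  have hVu : EqOn (deriv u) V (Ioo 0 L) := by
    refine isOpen_Ioo.eqOn_of_deriv_eq isPreconnected_Ioo hdu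
      (fun x _ => (hV x).differentiableAt.differentiableWithinAt) (fun x hx => ?_) hm (by simp [V])
    rw [(hV x).deriv, hqu x (Ioo_subset_Icc_self hx)]
    linarith [hu.equation x hx]
  have hUu : EqOn u U (Ioo 0 L) := by
    refine isOpen_Ioo.eqOn_of_deriv_eq isPreconnected_Ioo
      (hu.contDiffOn.differentiableOn two_ne_zero)
      (fun x _ => (hU x).differentiableAt.differentiableWithinAt) (fun x hx => ?_) hm (by simp [U])
    rw [(hU x).deriv, hVu hx]
  have hE : EqOn u U (Icc 0 L) :=
    hUu.of_subset_closure hu.continuousOn hUc.continuousOn Ioo_subset_Icc_self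
      (closure_Ioo hL.ne).ge
  refine ⟨U, V, hE, fun x _ => hU x, fun x hx => ?_, ?_, ?_⟩
  · rw [← hE hx, ← hqu x hx]
    exact hV x
  · rw [← hE ⟨le_rfl, hL.le⟩, hu.left_eq]
  · rw [← hE ⟨hL.le, le_rfl⟩, hu.right_eq]

/-! ### The primitive `F` and its inverse. -/

theorem hasDerivAt_primitive {f : ℝ → ℝ} (hf : Continuous f) (u : ℝ) :
    HasDerivAt (primitive f) (f u) u :=
  (hf.integral_hasStrictDerivAt 0 u).hasDerivAt

theorem primitive_zero (f : ℝ → ℝ) : primitive f 0 = 0 := by simp [primitive]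

theorem continuous_primitive {f : ℝ → ℝ} (hf : Continuous f) : Continuous (primitive f) :=
  continuous_iff_continuousAt.2 fun u => (hasDerivAt_primitive hf u).continuousAt

theorem strictMono_primitive {f : ℝ → ℝ} (hf : Continuous f) (hpos : ∀ u, 0 < f u) :
    StrictMono (primitive f) :=
  strictMono_of_deriv_pos fun u => by rw [(hasDerivAt_primitive hf u).deriv]; exact hpos u

/-- The bound `F' = f ≥ f 0` on `[0, ∞)` makes `F` reach every nonnegative value and `F⁻¹` Lipschitz
there with constant `1 / f 0`. -/
theorem mul_sub_le_primitive_sub {f : ℝ → ℝ} (hf : Continuous f) (hfm : Monotone f) {a b : ℝ}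
    (ha : 0 ≤ a) (hab : a ≤ b) : f 0 * (b - a) ≤ primitive f b - primitive f a := by
  refine (convex_Ici (0 : ℝ)).mul_sub_le_image_sub_of_le_deriv
    (continuous_primitive hf).continuousOn
    (fun x _ => (hasDerivAt_primitive hf x).differentiableAt.differentiableWithinAt)
    (fun x hx => ?_) a ha b (ha.trans hab) hab
  rw [(hasDerivAt_primitive hf x).deriv]
  rw [interior_Ici] at hx
  exact hfm (le_of_lt hx)

theorem primitive_invFun {f : ℝ → ℝ} (hf : Continuous f) (hpos : ∀ u, 0 < f u)
    (hfm : Monotone f) {w : ℝ} (hw : 0 ≤ w) :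
    primitive f (Function.invFun (primitive f) w) = w := by
  apply Function.invFun_eq
  have h0 : 0 ≤ w / f 0 := div_nonneg hw (hpos 0).le
  have h1 := mul_sub_le_primitive_sub hf hfm le_rfl h0
  rw [primitive_zero, sub_zero, sub_zero, mul_div_cancel₀ _ (hpos 0).ne'] at h1
  obtain ⟨x, -, hx⟩ := intermediate_value_Icc h0 (continuous_primitive hf).continuousOn
    (show w ∈ Icc (primitive f 0) (primitive f (w / f 0)) from ⟨by rwa [primitive_zero], h1⟩)
  exact ⟨x, hx⟩

theorem invFun_primitive {f : ℝ → ℝ} (hf : Continuous f) (hpos : ∀ u, 0 < f u) (u : ℝ) :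
    Function.invFun (primitive f) (primitive f u) = u :=
  Function.leftInverse_invFun (strictMono_primitive hf hpos).injective u

theorem invFun_primitive_nonneg {f : ℝ → ℝ} (hf : Continuous f) (hpos : ∀ u, 0 < f u)
    (hfm : Monotone f) {w : ℝ} (hw : 0 ≤ w) : 0 ≤ Function.invFun (primitive f) w := by
  rw [← (strictMono_primitive hf hpos).le_iff_le, primitive_zero, primitive_invFun hf hpos hfm hw]
  exact hw

theorem continuousOn_invFun_primitive {f : ℝ → ℝ} (hf : Continuous f) (hpos : ∀ u, 0 < f u)
    (hfm : Monotone f) : ContinuousOn (Function.invFun (primitive f)) (Ici 0) := by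
  have key : ∀ w ∈ Ici (0 : ℝ), ∀ z ∈ Ici (0 : ℝ),
      Function.invFun (primitive f) w ≤
        Function.invFun (primitive f) z + (f 0)⁻¹ * dist w z := by
    intro w hw z hz
    have h0 := inv_pos.2 (hpos 0)
    rcases le_total (Function.invFun (primitive f) w) (Function.invFun (primitive f) z) with h | h
    · have := mul_nonneg h0.le (dist_nonneg (x := w) (y := z))
      linarith
    · have h1 := mul_sub_le_primitive_sub hf hfm (invFun_primitive_nonneg hf hpos hfm hz) h
      rw [primitive_invFun hf hpos hfm hw, primitive_invFun hf hpos hfm hz, ← le_div_iff₀' (hpos 0),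
        div_eq_inv_mul] at h1
      have h2 := mul_le_mul_of_nonneg_left (le_abs_self (w - z)) h0.le
      rw [Real.dist_eq]
      linarith
  exact (LipschitzOnWith.of_le_add_mul' (f 0)⁻¹ key).continuousOn

/-- The integrand of the time map is continuous where its argument is in the range of `F`. -/
theorem continuousOn_timeMap_integrand {f : ℝ → ℝ} (hf : Continuous f) (hpos : ∀ u, 0 < f u)
    (hfm : Monotone f) {w : ℝ → ℝ} {s : Set ℝ} (hw : ContinuousOn w s) (hs : ∀ x ∈ s, 0 ≤ w x) :
    ContinuousOn (fun x => 1 / f (Function.invFun (primitive f) (w x))) s :=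
  continuousOn_const.div
    (hf.comp_continuousOn ((continuousOn_invFun_primitive hf hpos hfm).comp hw hs))
    fun _ _ => (hpos _).ne'

/-! ### Monotonicity of the time map. -/

theorem strictMonoOn_primitive_div_sq {f : ℝ → ℝ} (hf : ContDiff ℝ 1 f) (hpos : ∀ u, 0 < f u)
    (hg : ∀ u, 0 < u → 0 < gFun f u) :
    StrictMonoOn (fun u => primitive f u / f u ^ 2) (Ici 0) := by
  have hd : ∀ u, HasDerivAt (fun u => primitive f u / f u ^ 2)
      ((f u * f u ^ 2 - primitive f u * (2 * f u * deriv f u)) / (f u ^ 2) ^ 2) u := by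
    intro u
    have h1 := (hf.differentiable one_ne_zero u).hasDerivAt
    have h2 := (hasDerivAt_primitive hf.continuous u).fun_div (h1.fun_pow 2)
      (pow_ne_zero 2 (hpos u).ne')
    simpa using h2
  refine strictMonoOn_of_deriv_pos (convex_Ici 0)
    (fun u _ => (hd u).continuousAt.continuousWithinAt) fun u hu => ?_
  rw [interior_Ici] at hu
  rw [(hd u).deriv]
  have h1 : f u * f u ^ 2 - primitive f u * (2 * f u * deriv f u) = f u * gFun f u := by
    simp only [gFun]; ring
  rw [h1]
  exact div_pos (mul_pos (hpos u) (hg u hu)) (by have := hpos u; positivity)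

/-- The substitution `v = √(2C) t` frees the limits of `C`, so that two energies can be compared
pointwise. -/
theorem timeMap_eq_integral_unit {f : ℝ → ℝ} {lam C : ℝ} (hC : 0 < C) :
    timeMap f lam C = (1 / √lam) * ∫ t in (-1 : ℝ)..1,
      √(2 * C) * (1 / f (Function.invFun (primitive f) (C * (1 - t ^ 2)))) := by
  have h := intervalIntegral.smul_integral_comp_mul_left (a := -1) (b := 1)
    (fun v => 1 / f (Function.invFun (primitive f) (C - v ^ 2 / 2))) (√(2 * C))
  rw [mul_neg, mul_one] at h
  rw [timeMap, ← h, smul_eq_mul, intervalIntegral.integral_const_mul]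
  congr 3
  ext t
  rw [mul_pow, Real.sq_sqrt (by linarith)]
  congr 4
  ring

theorem strictMonoOn_timeMap {f : ℝ → ℝ} (hf : ContDiff ℝ 1 f) (hpos : ∀ u, 0 < f u)
    (hfm : Monotone f) {lam : ℝ} (hlam : 0 < lam) (hg : ∀ u, 0 < u → 0 < gFun f u) :
    StrictMonoOn (timeMap f lam) (Ioi 0) := by
  intro C hC D hD hCD
  rw [mem_Ioi] at hC hD
  have hcont : ∀ E : ℝ, 0 < E → ContinuousOn (fun t : ℝ =>
      √(2 * E) * (1 / f (Function.invFun (primitive f) (E * (1 - t ^ 2))))) (Icc (-1) 1) := by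
    intro E hE
    refine continuousOn_const.mul
      (continuousOn_timeMap_integrand hf.continuous hpos hfm (by fun_prop) fun t ht => ?_)
    have : t ^ 2 ≤ 1 := by nlinarith [ht.1, ht.2]
    exact mul_nonneg hE.le (by linarith)
  have hlt : ∀ t : ℝ, t ^ 2 ≤ 1 →
      √(2 * C) * (1 / f (Function.invFun (primitive f) (C * (1 - t ^ 2)))) <
        √(2 * D) * (1 / f (Function.invFun (primitive f) (D * (1 - t ^ 2)))) := by
    intro t ht
    have hs0 : 0 ≤ 1 - t ^ 2 := by linarith
    rw [mul_one_div, mul_one_div]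
    rcases hs0.eq_or_lt with hs | hs
    -- At `t = ±1` both denominators agree and only the prefactor grows.
    · rw [← hs, mul_zero, mul_zero]
      exact div_lt_div_of_pos_right (Real.sqrt_lt_sqrt (by linarith) (by linarith)) (hpos _)
    · set a := Function.invFun (primitive f) (C * (1 - t ^ 2)) with ha
      set b := Function.invFun (primitive f) (D * (1 - t ^ 2)) with hb
      have hCs := (mul_pos hC hs).le
      have hDs := (mul_pos hD hs).le
      have hFa : primitive f a = C * (1 - t ^ 2) := primitive_invFun hf.continuous hpos hfm hCs
      have hFb : primitive f b = D * (1 - t ^ 2) := primitive_invFun hf.continuous hpos hfm hDs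
      have hab : a < b := by
        rw [← (strictMono_primitive hf.continuous hpos).lt_iff_lt, hFa, hFb]
        exact mul_lt_mul_of_pos_right hCD hs
      have h := strictMonoOn_primitive_div_sq hf hpos hg
        (invFun_primitive_nonneg hf.continuous hpos hfm hCs)
        (invFun_primitive_nonneg hf.continuous hpos hfm hDs) hab
      simp only [← ha, ← hb, hFa, hFb] at h
      -- Cancelling `1 - t²` leaves `C / f(a)² < D / f(b)²`, half the squared integrands.
      rw [mul_div_right_comm, mul_div_right_comm, mul_lt_mul_iff_left₀ hs] at h
      refine lt_of_pow_lt_pow_left₀ 2 (div_nonneg (Real.sqrt_nonneg _) (hpos _).le) ?_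
      rw [div_pow, div_pow, Real.sq_sqrt (by linarith), Real.sq_sqrt (by linarith), mul_div_assoc,
        mul_div_assoc]
      linarith
  rw [timeMap_eq_integral_unit hC, timeMap_eq_integral_unit hD]
  refine mul_lt_mul_of_pos_left ?_ (one_div_pos.2 (Real.sqrt_pos.2 hlam))
  exact intervalIntegral.integral_lt_integral_of_continuousOn_of_le_of_exists_lt (by norm_num)
    (hcont C hC) (hcont D hD) (fun t ht => (hlt t (by nlinarith [ht.1, ht.2])).le)
    ⟨0, by norm_num, hlt 0 (by norm_num)⟩

/-! ### Phase plane: uniqueness, energy, symmetry, time map. -/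

namespace IsPhaseSolution

variable {f : ℝ → ℝ} {lam L : ℝ} {U V U₁ V₁ U₂ V₂ U₃ V₃ : ℝ → ℝ}

theorem continuousOn_fst (h : IsPhaseSolution f lam L U V) : ContinuousOn U (Icc 0 L) :=
  fun x hx => (h.hasDerivAt_fst x hx).continuousAt.continuousWithinAt

theorem continuousOn_snd (h : IsPhaseSolution f lam L U V) : ContinuousOn V (Icc 0 L) :=
  fun x hx => (h.hasDerivAt_snd x hx).continuousAt.continuousWithinAt

/-- Solutions of the phase plane system with the same initial velocity agree. -/
theorem eqOn (hf : ContDiff ℝ 1 f) (h₁ : IsPhaseSolution f lam L U₁ V₁)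
    (h₂ : IsPhaseSolution f lam L U₂ V₂) (h0 : V₁ 0 = V₂ 0) :
    EqOn U₁ U₂ (Icc 0 L) ∧ EqOn V₁ V₂ (Icc 0 L) := by
  let v : ℝ × ℝ → ℝ × ℝ := fun y => (y.2, -(lam * f y.1))
  have hv : ContDiff ℝ 1 v := by fun_prop
  have hc₁ : ContinuousOn (fun x => (U₁ x, V₁ x)) (Icc 0 L) :=
    h₁.continuousOn_fst.prodMk h₁.continuousOn_snd
  have hc₂ : ContinuousOn (fun x => (U₂ x, V₂ x)) (Icc 0 L) :=
    h₂.continuousOn_fst.prodMk h₂.continuousOn_snd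
  -- The field is only locally Lipschitz; compactness of the two trajectories supplies one constant.
  obtain ⟨K, hK⟩ := (hv.locallyLipschitz.locallyLipschitzOn
    (s := (fun x => (U₁ x, V₁ x)) '' Icc 0 L ∪ (fun x => (U₂ x, V₂ x)) '' Icc 0 L)
    ).exists_lipschitzOnWith_of_compact
    ((isCompact_Icc.image_of_continuousOn hc₁).union (isCompact_Icc.image_of_continuousOn hc₂))
  have hE := ODE_solution_unique_of_mem_Icc_right (v := fun _ => v) (fun _ _ => hK) hc₁
    (fun t ht => ((h₁.hasDerivAt_fst t (Ico_subset_Icc_self ht)).prodMk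
      (h₁.hasDerivAt_snd t (Ico_subset_Icc_self ht))).hasDerivWithinAt)
    (fun t ht => Or.inl (mem_image_of_mem _ (Ico_subset_Icc_self ht))) hc₂
    (fun t ht => ((h₂.hasDerivAt_fst t (Ico_subset_Icc_self ht)).prodMk
      (h₂.hasDerivAt_snd t (Ico_subset_Icc_self ht))).hasDerivWithinAt)
    (fun t ht => Or.inr (mem_image_of_mem _ (Ico_subset_Icc_self ht)))
    (by simp only [h₁.left_eq, h₂.left_eq, h0])
  exact ⟨fun x hx => congrArg Prod.fst (hE hx), fun x hx => congrArg Prod.snd (hE hx)⟩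

/-- Conservation of energy. -/
theorem energy_eq (hf : Continuous f) (h : IsPhaseSolution f lam L U V) {x : ℝ}
    (hx : x ∈ Icc 0 L) : V x ^ 2 / 2 + lam * primitive f (U x) = V 0 ^ 2 / 2 := by
  have hd : ∀ y ∈ Icc 0 L,
      HasDerivAt (fun y => V y ^ 2 / 2 + lam * primitive f (U y)) 0 y := by
    intro y hy
    have h1 := ((h.hasDerivAt_snd y hy).fun_pow 2).div_const 2
    have h2 := ((hasDerivAt_primitive hf (U y)).comp y (h.hasDerivAt_fst y hy)).const_mul lam
    refine (h1.add h2).congr_deriv ?_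
    simp only [Nat.cast_ofNat, Nat.add_one_sub_one, pow_one]
    ring
  have h0 := constant_of_has_deriv_right_zero
    (fun y hy => (hd y hy).continuousAt.continuousWithinAt)
    (fun y hy => (hd y (Ico_subset_Icc_self hy)).hasDerivWithinAt) x hx
  simpa [h.left_eq, primitive_zero] using h0

theorem strictAntiOn_snd (hpos : ∀ u, 0 < f u) (hlam : 0 < lam)
    (h : IsPhaseSolution f lam L U V) : StrictAntiOn V (Icc 0 L) := by
  refine strictAntiOn_of_deriv_neg (convex_Icc 0 L) h.continuousOn_snd fun x hx => ?_
  rw [(h.hasDerivAt_snd x (interior_subset hx)).deriv]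
  exact neg_neg_of_pos (mul_pos hlam (hpos _))

/-- Energy gives `V(L)² = V(0)²`, and strict decrease of `V` rules out equal signs. -/
theorem snd_right_eq (hf : Continuous f) (hpos : ∀ u, 0 < f u) (hlam : 0 < lam) (hL : 0 < L)
    (h : IsPhaseSolution f lam L U V) : V L = -V 0 := by
  have h1 := h.energy_eq hf ⟨hL.le, le_rfl⟩
  rw [h.right_eq, primitive_zero, mul_zero, add_zero] at h1
  have h2 := h.strictAntiOn_snd hpos hlam ⟨le_rfl, hL.le⟩ ⟨hL.le, le_rfl⟩ hL
  exact (sq_eq_sq_iff_eq_or_eq_neg.1 (by linarith)).resolve_left h2.ne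

theorem snd_zero_pos (hf : Continuous f) (hpos : ∀ u, 0 < f u) (hlam : 0 < lam) (hL : 0 < L)
    (h : IsPhaseSolution f lam L U V) : 0 < V 0 := by
  have h1 := h.strictAntiOn_snd hpos hlam ⟨le_rfl, hL.le⟩ ⟨hL.le, le_rfl⟩ hL
  rw [h.snd_right_eq hf hpos hlam hL] at h1
  linarith

/-- Reflection about the midpoint of the interval. -/
theorem reflect (h : IsPhaseSolution f lam L U V) :
    IsPhaseSolution f lam L (fun x => U (L - x)) (fun x => -V (L - x)) where
  hasDerivAt_fst x hx :=
    (h.hasDerivAt_fst (L - x) ⟨by linarith [hx.2], by linarith [hx.1]⟩).comp_const_sub L x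
  hasDerivAt_snd x hx := by
    have hd := ((h.hasDerivAt_snd (L - x)
      ⟨by linarith [hx.2], by linarith [hx.1]⟩).comp_const_sub L x).fun_neg
    rwa [neg_neg] at hd
  left_eq := by simpa using h.right_eq
  right_eq := by simpa using h.left_eq

/-- The reflected solution has initial velocity `-V L = V 0`, so uniqueness applies. -/
theorem symm (hf : ContDiff ℝ 1 f) (hpos : ∀ u, 0 < f u) (hlam : 0 < lam) (hL : 0 < L)
    (h : IsPhaseSolution f lam L U V) {x : ℝ} (hx : x ∈ Icc 0 L) :
    U x = U (L - x) ∧ V x = -V (L - x) := by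
  have hE := h.eqOn hf h.reflect
    (by simp only [sub_zero]; rw [h.snd_right_eq hf.continuous hpos hlam hL, neg_neg])
  exact ⟨hE.1 hx, hE.2 hx⟩

theorem snd_nonneg (hf : ContDiff ℝ 1 f) (hpos : ∀ u, 0 < f u) (hlam : 0 < lam) (hL : 0 < L)
    (h : IsPhaseSolution f lam L U V) {x : ℝ} (hx : x ∈ Icc 0 (L / 2)) : 0 ≤ V x := by
  have hm : L / 2 ∈ Icc 0 L := ⟨by linarith, by linarith⟩
  have h1 := (h.symm hf hpos hlam hL hm).2
  rw [sub_half] at h1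
  have h2 := (h.strictAntiOn_snd hpos hlam).antitoneOn ⟨hx.1, by linarith [hx.2]⟩ hm hx.2
  linarith

theorem fst_nonneg (hf : ContDiff ℝ 1 f) (hpos : ∀ u, 0 < f u) (hlam : 0 < lam) (hL : 0 < L)
    (h : IsPhaseSolution f lam L U V) {x : ℝ} (hx : x ∈ Icc 0 L) : 0 ≤ U x := by
  have hsub : Icc 0 (L / 2) ⊆ Icc 0 L := Icc_subset_Icc_right (by linarith)
  have hm : MonotoneOn U (Icc 0 (L / 2)) := by
    refine monotoneOn_of_deriv_nonneg (convex_Icc _ _) (h.continuousOn_fst.mono hsub)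
      (fun y hy => (h.hasDerivAt_fst y
        (hsub (interior_subset hy))).differentiableAt.differentiableWithinAt) fun y hy => ?_
    rw [(h.hasDerivAt_fst y (hsub (interior_subset hy))).deriv]
    exact h.snd_nonneg hf hpos hlam hL (interior_subset hy)
  have key : ∀ y ∈ Icc 0 (L / 2), 0 ≤ U y := fun y hy =>
    h.left_eq.symm.le.trans (hm ⟨le_rfl, by linarith⟩ hy hy.1)
  rcases le_total x (L / 2) with hxm | hxm
  · exact key x ⟨hx.1, hxm⟩
  · rw [(h.symm hf hpos hlam hL hx).1]
    exact key _ ⟨by linarith [hx.2], by linarith⟩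

/-- The length of the interval is the value of the time map at the energy level. -/
theorem eq_timeMap (hf : ContDiff ℝ 1 f) (hpos : ∀ u, 0 < f u) (hfm : Monotone f)
    (hlam : 0 < lam) (hL : 0 < L) (h : IsPhaseSolution f lam L U V) :
    L = timeMap f lam (V 0 ^ 2 / (2 * lam)) := by
  set C := V 0 ^ 2 / (2 * lam) with hC
  have hsl : 0 < √lam := Real.sqrt_pos.2 hlam
  have hV0 := h.snd_zero_pos hf.continuous hpos hlam hL
  have hroot : √(2 * C) = V 0 / √lam := by
    rw [← Real.sqrt_sq hV0.le, ← Real.sqrt_div (sq_nonneg _)]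
    congr 1
    rw [hC]
    field_simp
  have hF : ∀ x ∈ Icc 0 L, C - (V x / √lam) ^ 2 / 2 = primitive f (U x) := by
    intro x hx
    have h1 := h.energy_eq hf.continuous hx
    rw [div_pow, Real.sq_sqrt hlam.le, hC]
    field_simp
    linarith
  have hcont : ContinuousOn (fun x => V x / √lam) (uIcc 0 L) := by
    rw [uIcc_of_le hL.le]
    exact h.continuousOn_snd.div_const _
  -- With `v = V x / √λ`, energy gives `F⁻¹(C - v² / 2) = U x`, so the transformed integrand is the
  -- constant `-√λ`. The limits come out reversed because `V` decreases.
  have hsub := intervalIntegral.integral_comp_mul_deriv'' (a := 0) (b := L)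
    (f := fun x => V x / √lam) (f' := fun x => -(lam * f (U x)) / √lam)
    (g := fun v => 1 / f (Function.invFun (primitive f) (C - v ^ 2 / 2))) hcont
    (fun x hx => by
      rw [min_eq_left hL.le, max_eq_right hL.le] at hx
      exact ((h.hasDerivAt_snd x (Ioo_subset_Icc_self hx)).div_const _).hasDerivWithinAt)
    (by
      rw [uIcc_of_le hL.le]
      exact ((continuousOn_const.mul
        (hf.continuous.comp_continuousOn h.continuousOn_fst)).neg).div_const _)
    (by
      refine continuousOn_timeMap_integrand hf.continuous hpos hfm (by fun_prop) ?_
      rintro _ ⟨x, hx, rfl⟩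
      rw [uIcc_of_le hL.le] at hx
      simp only [hF x hx]
      rw [← primitive_zero f]
      exact (strictMono_primitive hf.continuous hpos).monotone (h.fst_nonneg hf hpos hlam hL hx))
  have hleft : (∫ x in (0 : ℝ)..L, ((fun v => 1 / f (Function.invFun (primitive f)
      (C - v ^ 2 / 2))) ∘ fun x => V x / √lam) x * (-(lam * f (U x)) / √lam)) = -(√lam * L) := by
    have : (∫ x in (0 : ℝ)..L, ((fun v => 1 / f (Function.invFun (primitive f)
      (C - v ^ 2 / 2))) ∘ fun x => V x / √lam) x * (-(lam * f (U x)) / √lam)) =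
        ∫ _ in (0 : ℝ)..L, -√lam := by
      refine intervalIntegral.integral_congr fun x hx => ?_
      rw [uIcc_of_le hL.le] at hx
      simp only [Function.comp_apply, hF x hx, invFun_primitive hf.continuous hpos]
      have h1 := (hpos (U x)).ne'
      have h2 : lam = √lam * √lam := (Real.mul_self_sqrt hlam.le).symm
      rw [div_mul_div_comm, one_mul, div_eq_iff (mul_ne_zero h1 hsl.ne')]
      linear_combination (-(f (U x))) * h2
    rw [this, intervalIntegral.integral_const, smul_eq_mul]
    ring
  rw [hleft] at hsub
  simp only [h.snd_right_eq hf.continuous hpos hlam hL] at hsub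
  rw [timeMap, hroot, ← neg_div, intervalIntegral.integral_symm, ← hsub]
  field_simp

/-! ### Ordering and the exclusion of three solutions. -/

/-- A solution with larger initial velocity lies above. -/
theorem lt_of_snd_zero_lt (hf : ContDiff ℝ 1 f) (hpos : ∀ u, 0 < f u) (hlam : 0 < lam)
    (hL : 0 < L) (h₁ : IsPhaseSolution f lam L U₁ V₁) (h₂ : IsPhaseSolution f lam L U₂ V₂)
    (h0 : V₁ 0 < V₂ 0) {x : ℝ} (hx : x ∈ Ioo 0 L) : U₁ x < U₂ x := by
  have hsub : Icc 0 (L / 2) ⊆ Icc 0 L := Icc_subset_Icc_right (by linarith)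
  -- At a common value of `U` the energies give `V₁² < V₂²`, and `V₂ ≥ 0` on the left half.
  have hcross : ∀ y ∈ Icc 0 (L / 2), U₁ y = U₂ y → V₁ y < V₂ y := by
    intro y hy hEq
    have e₁ := h₁.energy_eq hf.continuous (hsub hy)
    have e₂ := h₂.energy_eq hf.continuous (hsub hy)
    rw [hEq] at e₁
    have h3 := pow_lt_pow_left₀ h0 (h₁.snd_zero_pos hf.continuous hpos hlam hL).le two_ne_zero
    exact lt_of_pow_lt_pow_left₀ 2 (h₂.snd_nonneg hf hpos hlam hL hy) (by linarith)
  have hle : ∀ y ∈ Icc 0 (L / 2), U₁ y ≤ U₂ y :=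
    fun y hy => image_le_of_deriv_right_lt_deriv_boundary' (h₁.continuousOn_fst.mono hsub)
      (fun z hz => (h₁.hasDerivAt_fst z (hsub (Ico_subset_Icc_self hz))).hasDerivWithinAt)
      (by rw [h₁.left_eq, h₂.left_eq]) (h₂.continuousOn_fst.mono hsub)
      (fun z hz => (h₂.hasDerivAt_fst z (hsub (Ico_subset_Icc_self hz))).hasDerivWithinAt)
      (fun z hz => hcross z (Ico_subset_Icc_self hz)) hy
  have key : ∀ y ∈ Ioc 0 (L / 2), U₁ y < U₂ y := by
    intro y hy
    have hy' := Ioc_subset_Icc_self hy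
    refine (hle y hy').lt_of_ne fun hEq => ?_
    -- At a contact point `U₂ - U₁` would vanish with positive derivative, hence be negative just to
    -- the left.
    have hd := (h₂.hasDerivAt_fst y (hsub hy')).sub (h₁.hasDerivAt_fst y (hsub hy'))
    have hs := hd.hasDerivWithinAt (s := Iio y)
    rw [hasDerivWithinAt_iff_tendsto_slope' (by simp)] at hs
    have hev := hs.eventually (lt_mem_nhds (sub_pos.2 (hcross y hy' hEq)))
    obtain ⟨z, hz, hzy⟩ := (hev.and (Ioo_mem_nhdsLT hy.1)).exists
    have hz0 := hle z ⟨hzy.1.le, hzy.2.le.trans hy.2⟩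
    rw [slope_def_field] at hz
    have hneg : z - y < 0 := sub_neg.2 hzy.2
    simp only [Pi.sub_apply] at hz
    exact hz.not_ge (div_nonpos_of_nonneg_of_nonpos (by linarith) hneg.le)
  rcases le_total x (L / 2) with hxm | hxm
  · exact key x ⟨hx.1, hxm⟩
  · have hx' := Ioo_subset_Icc_self hx
    rw [(h₁.symm hf hpos hlam hL hx').1, (h₂.symm hf hpos hlam hL hx').1]
    exact key _ ⟨by linarith [hx.2], by linarith⟩

/-- For strictly convex `f` there are no three strictly ordered solutions, by comparison of the
linear equations satisfied by the consecutive differences. -/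
theorem not_lt_lt (hL : 0 < L) (hlam : 0 < lam) (hconv : StrictConvexOn ℝ (Ici 0) f)
    (h₁ : IsPhaseSolution f lam L U₁ V₁) (h₂ : IsPhaseSolution f lam L U₂ V₂)
    (h₃ : IsPhaseSolution f lam L U₃ V₃) (hnonneg : ∀ x ∈ Icc 0 L, 0 ≤ U₁ x)
    (h12 : ∀ x ∈ Ioo 0 L, U₁ x < U₂ x) (h23 : ∀ x ∈ Ioo 0 L, U₂ x < U₃ x) : False := by
  have hd : ∀ x ∈ Icc 0 L, HasDerivAt
      (fun x => (V₂ x - V₁ x) * (U₃ x - U₂ x) - (U₂ x - U₁ x) * (V₃ x - V₂ x))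
      (lam * ((U₂ x - U₁ x) * (f (U₃ x) - f (U₂ x)) - (f (U₂ x) - f (U₁ x)) * (U₃ x - U₂ x)))
      x := by
    intro x hx
    have a₁ := h₁.hasDerivAt_fst x hx
    have a₂ := h₂.hasDerivAt_fst x hx
    have a₃ := h₃.hasDerivAt_fst x hx
    have b₁ := h₁.hasDerivAt_snd x hx
    have b₂ := h₂.hasDerivAt_snd x hx
    have b₃ := h₃.hasDerivAt_snd x hx
    refine (((b₂.fun_sub b₁).fun_mul (a₃.fun_sub a₂)).fun_sub
      ((a₂.fun_sub a₁).fun_mul (b₃.fun_sub b₂))).congr_deriv ?_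
    ring
  obtain ⟨c, hc, hc0⟩ := exists_hasDerivAt_eq_zero hL
    (fun x hx => (hd x hx).continuousAt.continuousWithinAt)
    (by simp only [h₁.left_eq, h₂.left_eq, h₃.left_eq, h₁.right_eq, h₂.right_eq, h₃.right_eq]
        ring)
    (fun x hx => hd x (Ioo_subset_Icc_self hx))
  have h1 := hnonneg c (Ioo_subset_Icc_self hc)
  -- The Wronskian derivative is `λ (U₂ - U₁)(U₃ - U₂)` times the difference of adjacent slopes of
  -- `f`, so it cannot vanish as Rolle demands.
  have hs := hconv.slope_strict_mono_adjacent (mem_Ici.2 h1)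
    (mem_Ici.2 (h1.trans ((h12 c hc).trans (h23 c hc)).le)) (h12 c hc) (h23 c hc)
  rw [div_lt_div_iff₀ (sub_pos.2 (h12 c hc)) (sub_pos.2 (h23 c hc))] at hs
  rcases mul_eq_zero.1 hc0 with h | h
  · exact hlam.ne' h
  · linarith

end IsPhaseSolution

/-! ### Assembly of the two parts. -/

theorem mainTheorem3 (f : ℝ → ℝ) (hf : ContDiff ℝ 1 f)
    (hpos : ∀ u, 0 < f u) (hmono : ∀ u, 0 ≤ deriv f u)
    (lam : ℝ) (hlam : 0 < lam) :
    ((∀ u, 0 < u → 0 < gFun f u) →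
      StrictMonoOn (timeMap f lam) (Set.Ioi 0) ∧
      ∀ L : ℝ, 0 < L → ∀ u₁ u₂ : ℝ → ℝ,
        IsDirichletSolution f lam L u₁ → IsDirichletSolution f lam L u₂ →
        Set.EqOn u₁ u₂ (Set.Icc 0 L)) ∧
    (ContDiff ℝ 2 f → (∀ u, 0 < u → 0 < deriv (deriv f) u) →
      ∀ L : ℝ, 0 < L →
        (∀ u₁ u₂ u₃ : ℝ → ℝ, IsDirichletSolution f lam L u₁ →
          IsDirichletSolution f lam L u₂ → IsDirichletSolution f lam L u₃ →
          Set.EqOn u₁ u₂ (Set.Icc 0 L) ∨ Set.EqOn u₁ u₃ (Set.Icc 0 L) ∨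
            Set.EqOn u₂ u₃ (Set.Icc 0 L)) ∧
        (∀ u₁ u₂ : ℝ → ℝ, IsDirichletSolution f lam L u₁ → IsDirichletSolution f lam L u₂ →
          ¬ Set.EqOn u₁ u₂ (Set.Icc 0 L) →
          (∀ x ∈ Set.Ioo 0 L, u₁ x < u₂ x) ∨ (∀ x ∈ Set.Ioo 0 L, u₂ x < u₁ x))) := by
  have hfm : Monotone f := monotone_of_deriv_nonneg (hf.differentiable one_ne_zero) hmono
  constructor
  · intro hg
    have hT := strictMonoOn_timeMap hf hpos hfm hlam hg
    refine ⟨hT, fun L hL u₁ u₂ hu₁ hu₂ => ?_⟩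
    obtain ⟨U₁, V₁, hE₁, h₁⟩ := hu₁.exists_isPhaseSolution hf.continuous hL
    obtain ⟨U₂, V₂, hE₂, h₂⟩ := hu₂.exists_isPhaseSolution hf.continuous hL
    have p₁ := h₁.snd_zero_pos hf.continuous hpos hlam hL
    have p₂ := h₂.snd_zero_pos hf.continuous hpos hlam hL
    have hC : V₁ 0 ^ 2 / (2 * lam) = V₂ 0 ^ 2 / (2 * lam) :=
      hT.injOn (mem_Ioi.2 (by positivity)) (mem_Ioi.2 (by positivity))
        ((h₁.eq_timeMap hf hpos hfm hlam hL).symm.trans (h₂.eq_timeMap hf hpos hfm hlam hL))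
    have hV : V₁ 0 = V₂ 0 := by
      rw [div_left_inj' (by positivity)] at hC
      exact (pow_left_inj₀ p₁.le p₂.le two_ne_zero).1 hC
    exact hE₁.trans ((h₁.eqOn hf h₂ hV).1.trans hE₂.symm)
  · intro _ hf'' L hL
    have hconv : StrictConvexOn ℝ (Ici 0) f :=
      strictConvexOn_of_deriv2_pos (convex_Ici 0) hf.continuous.continuousOn fun x hx =>
        hf'' x (by rwa [interior_Ici] at hx)
    constructor
    · intro u₁ u₂ u₃ hu₁ hu₂ hu₃
      obtain ⟨U₁, V₁, hE₁, h₁⟩ := hu₁.exists_isPhaseSolution hf.continuous hL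
      obtain ⟨U₂, V₂, hE₂, h₂⟩ := hu₂.exists_isPhaseSolution hf.continuous hL
      obtain ⟨U₃, V₃, hE₃, h₃⟩ := hu₃.exists_isPhaseSolution hf.continuous hL
      -- Equal initial velocities mean equal solutions, so three distinct solutions would have
      -- distinct velocities and form a chain.
      have no_chain : ∀ {U V U' V' U'' V'' : ℝ → ℝ}, IsPhaseSolution f lam L U V →
          IsPhaseSolution f lam L U' V' → IsPhaseSolution f lam L U'' V'' →
          V 0 < V' 0 → V' 0 < V'' 0 → False := fun h h' h'' l l' =>
        h.not_lt_lt hL hlam hconv h' h'' (fun x hx => h.fst_nonneg hf hpos hlam hL hx)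
          (fun x hx => h.lt_of_snd_zero_lt hf hpos hlam hL h' l hx)
          (fun x hx => h'.lt_of_snd_zero_lt hf hpos hlam hL h'' l' hx)
      rcases lt_trichotomy (V₁ 0) (V₂ 0) with l | l | l
      · rcases lt_trichotomy (V₂ 0) (V₃ 0) with m | m | m
        · exact (no_chain h₁ h₂ h₃ l m).elim
        · exact Or.inr (Or.inr (hE₂.trans ((h₂.eqOn hf h₃ m).1.trans hE₃.symm)))
        · rcases lt_trichotomy (V₁ 0) (V₃ 0) with n | n | n
          · exact (no_chain h₁ h₃ h₂ n m).elim
          · exact Or.inr (Or.inl (hE₁.trans ((h₁.eqOn hf h₃ n).1.trans hE₃.symm)))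
          · exact (no_chain h₃ h₁ h₂ n l).elim
      · exact Or.inl (hE₁.trans ((h₁.eqOn hf h₂ l).1.trans hE₂.symm))
      · rcases lt_trichotomy (V₁ 0) (V₃ 0) with m | m | m
        · exact (no_chain h₂ h₁ h₃ l m).elim
        · exact Or.inr (Or.inl (hE₁.trans ((h₁.eqOn hf h₃ m).1.trans hE₃.symm)))
        · rcases lt_trichotomy (V₂ 0) (V₃ 0) with n | n | n
          · exact (no_chain h₂ h₃ h₁ n m).elim
          · exact Or.inr (Or.inr (hE₂.trans ((h₂.eqOn hf h₃ n).1.trans hE₃.symm)))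
          · exact (no_chain h₃ h₂ h₁ n l).elim
    · intro u₁ u₂ hu₁ hu₂ hne
      obtain ⟨U₁, V₁, hE₁, h₁⟩ := hu₁.exists_isPhaseSolution hf.continuous hL
      obtain ⟨U₂, V₂, hE₂, h₂⟩ := hu₂.exists_isPhaseSolution hf.continuous hL
      rcases lt_trichotomy (V₁ 0) (V₂ 0) with l | l | l
      · refine Or.inl fun x hx => ?_
        rw [hE₁ (Ioo_subset_Icc_self hx), hE₂ (Ioo_subset_Icc_self hx)]
        exact h₁.lt_of_snd_zero_lt hf hpos hlam hL h₂ l hx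
      · exact (hne (hE₁.trans ((h₁.eqOn hf h₂ l).1.trans hE₂.symm))).elim
      · refine Or.inr fun x hx => ?_
        rw [hE₁ (Ioo_subset_Icc_self hx), hE₂ (Ioo_subset_Icc_self hx)]
        exact h₂.lt_of_snd_zero_lt hf hpos hlam hL h₁ l hx
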